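/- Throughout, $r\ge 3$ is an odd integer, $q=e^{2\pi i/r}$, $\{n\}=q^n-q^{-n}$, $\{n\}!=\prod_{i=1}^n\{i\}$ and $\zeta_r=2\sin(2\pi/r)$. A triple $(a,b,c)$ of non-negative integers is $r$-admissible if $a,b,c\le r-2$, $a+b+c$ is even and at most $2r-4$, and each of $a,b,c$ is at most the sum of the other two; for such a triple let $$\Delta(a,b,c)=\left(\sqrt{-1}\,\zeta_r\,\frac{\{\frac{a+b-c}{2}\}!\,\{\frac{a-b+c}{2}\}!\,\{\frac{-a+b+c}{2}\}!}{\{\frac{a+b+c}{2}+1\}!}\right)^{1/2},$$ where the radicand is real, and the root is the positive one of a positive number and the one with positive imaginary part of a negative number. A $6$-tuple $(n_1,\dots,n_6)$ is $r$-admissible if the triples $v_1=(n_1,n_2,n_3)$, $v_2=(n_1,n_5,n_6)$, $v_3=(n_2,n_4,n_6)$, $v_4=(n_3,n_4,n_5)$ are; its quantum $6j$-symbol at $q=e^{2\pi i/r}$ is $$\begin{vmatrix} n_1&n_2&n_3\\ n_4&n_5&n_6\end{vmatrix}=\zeta_r^{-1}(\sqrt{-1})^{n_1+\cdots+n_6}\prod_{i=1}^4\Delta(v_i)\sum_{z=\max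 T_i}^{\min Q_j}\frac{(-1)^z\{z+1\}!}{\prod_{i=1}^4\{z-T_i\}!\,\prod_{j=1}^3\{Q_j-z\}!},$$ where $T_i$ is half the sum of the entries of $v_i$, and $Q_1=\frac{n_1+n_2+n_4+n_5}{2}$, $Q_2=\frac{n_1+n_3+n_4+n_6}{2}$, $Q_3=\frac{n_2+n_3+n_5+n_6}{2}$. Let $v_8$ be the hyperbolic volume of the regular ideal octahedron in hyperbolic $3$-space. **Lemma.** For each odd $r\ge 3$ let $n_r$ be the one of the two integers $\frac{r+1}{2},\frac{r-1}{2}$ that is even. Then, for all sufficiently large odd $r$, the $6$-tuple $(n_r,n_r,n_r,n_r,n_r,n_r)$ is $r$-admissible, and, as $r$ tends to infinity through the odd integers, $$\lim_{r\to\infty}\frac{2\pi}{r}\log\left|\begin{vmatrix} n_r&n_r&n_r\\ n_r&n_r&n_r\end{vmatrix}_{q=e^{2\pi i/r}}\right|=v_8.$$ -/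

import Mathlib

open scoped Topology

noncomputable section

namespace QuantumSixJ

/-- The root of unity `q = exp(2πi/r)`. -/
def root (r : ℕ) : ℂ := Complex.exp (2 * Real.pi * Complex.I / r)

/-- The quantum integer `{n} = q ^ n - q ^ (-n)` at `q = exp(2πi/r)`. -/
def qInt (r : ℕ) (n : ℤ) : ℂ := root r ^ n - root r ^ (-n)

/-- The quantum factorial `{n}! = {1}{2}⋯{n}` at `q = exp(2πi/r)`. -/
def qFactorial (r n : ℕ) : ℂ := ∏ i ∈ Finset.Icc 1 n, qInt r i

/-- `ζ_r = 2 sin (2π/r)`. -/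
def zeta (r : ℕ) : ℝ := 2 * Real.sin (2 * Real.pi / r)

/-- `r`-admissible triples of colors. -/
def AdmissibleTriple (r a b c : ℕ) : Prop :=
  (a + 2 ≤ r ∧ b + 2 ≤ r ∧ c + 2 ≤ r) ∧
  (Even (a + b + c) ∧ a + b + c + 4 ≤ 2 * r) ∧
  (a ≤ b + c ∧ b ≤ a + c ∧ c ≤ a + b)

/-- `r`-admissible 6-tuples of colors. -/
def Admissible (r n₁ n₂ n₃ n₄ n₅ n₆ : ℕ) : Prop :=
  AdmissibleTriple r n₁ n₂ n₃ ∧ AdmissibleTriple r n₁ n₅ n₆ ∧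
  AdmissibleTriple r n₂ n₄ n₆ ∧ AdmissibleTriple r n₃ n₄ n₅

/-- `Δ(a, b, c)`, for `r`-admissible triples; all natural number subtractions and divisions are
then exact. The radicand is a real number, and the principal branch of the complex power `1 / 2`
is the nonnegative root of a nonnegative real and the root with positive imaginary part of a
negative real. -/
def Delta (r a b c : ℕ) : ℂ :=
  (Complex.I * (zeta r : ℂ) *
    (qFactorial r ((a + b - c) / 2) * qFactorial r ((a + c - b) / 2) *
      qFactorial r ((b + c - a) / 2)) / qFactorial r ((a + b + c) / 2 + 1)) ^ (1 / 2 : ℂ)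

/-- The quantum `6j`-symbol of an `r`-admissible 6-tuple, at `q = exp(2πi/r)`. Here too, on
admissible 6-tuples all natural number subtractions and divisions are exact. -/
def sixJ (r n₁ n₂ n₃ n₄ n₅ n₆ : ℕ) : ℂ :=
  let T₁ := (n₁ + n₂ + n₃) / 2
  let T₂ := (n₁ + n₅ + n₆) / 2
  let T₃ := (n₂ + n₄ + n₆) / 2
  let T₄ := (n₃ + n₄ + n₅) / 2
  let Q₁ := (n₁ + n₂ + n₄ + n₅) / 2
  let Q₂ := (n₁ + n₃ + n₄ + n₆) / 2
  let Q₃ := (n₂ + n₃ + n₅ + n₆) / 2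
  (zeta r : ℂ)⁻¹ * Complex.I ^ (n₁ + n₂ + n₃ + n₄ + n₅ + n₆) *
    (Delta r n₁ n₂ n₃ * Delta r n₁ n₅ n₆ * Delta r n₂ n₄ n₆ * Delta r n₃ n₄ n₅) *
    ∑ z ∈ Finset.Icc (max (max T₁ T₂) (max T₃ T₄)) (min Q₁ (min Q₂ Q₃)),
      (-1 : ℂ) ^ z * qFactorial r (z + 1) /
        ((qFactorial r (z - T₁) * qFactorial r (z - T₂) * qFactorial r (z - T₃) *
            qFactorial r (z - T₄)) *
          (qFactorial r (Q₁ - z) * qFactorial r (Q₂ - z) * qFactorial r (Q₃ - z)))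

/-- Hyperbolic volume in the projective (Klein) model of hyperbolic 3-space: the open unit ball
with the metric `|dx|² / (1 - |x|²) + ⟨x, dx⟩² / (1 - |x|²)²`. The determinant of this metric is
`(1 - |x|²)⁻⁴`, so that its volume form has density `(1 - |x|²)⁻²`. -/
def hyperbolicVolume : MeasureTheory.Measure (EuclideanSpace ℝ (Fin 3)) :=
  (MeasureTheory.volume.restrict (Metric.ball 0 1)).withDensity
    fun x => ENNReal.ofReal (((1 - ‖x‖ ^ 2) ^ 2)⁻¹)

/-- The regular ideal octahedron in the projective model, where hyperbolic convex hulls are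
Euclidean convex hulls: its ideal vertices are the six points `±eᵢ` of the sphere at infinity. -/
def idealOctahedron : Set (EuclideanSpace ℝ (Fin 3)) :=
  convexHull ℝ {v | ∃ i, v = EuclideanSpace.single i 1 ∨ v = -EuclideanSpace.single i 1}

/-- `v₈`, the hyperbolic volume of the regular ideal octahedron. -/
def v8 : ℝ := (hyperbolicVolume idealOctahedron).toReal

end QuantumSixJ

end

namespace QuantumSixJ

/-! ### Quantum factorials and the `6j`-symbol as a sum of positive terms -/

/-! Write S(m) for `sineProd r m` and n_r = 2N, so that r = 4N ± 1. All T_i equal 3N and all Q_j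
equal 4N. The growth rate comes from three facts.

No cancellation. Since {m}! = i^m S(m), each term of the sum is a real number times a power of i.
The reflection sin(2π(r-k)/r) = -sin(2πk/r) together with |S(r-1)| = r (`sineProd_reflect`,
`abs_sineProd_pred`) shows that, for z ≥ 3N, the nonzero terms all have the same phase. Hence the
norm of the sum is the sum of the norms (`sum_eq`), and its exponential growth is that of the
largest term.

The largest term. Put j = 4N - z. Reflection turns |{z+1}!| into r / S(j-d) with d = 4N + 2 - r,
which is 1 or 3, so up to bounded factors the term is r / (S(j) S(N-j))^4. The product S(j) S(N-j)
is smallest at j = N/2 (`sineProd_mul_min`). Riemann sums give (2π/r) log S(m) → L(2πc) when m/r →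
c, where L is `logSinPrim` (`tendsto_log_sineProd`). Since N/2 is about r/8, the sum contributes -8
L(π/4). The prefactor involves only ζ_r, r and S near r/4, and contributes nothing because L(π/2) =
0.

The volume. In the Klein model the ideal octahedron is the unit ball of the ℓ¹ norm. In cylindrical
coordinates the radial and height integrals are elementary; the remaining angular integral of log((1
+ |sin s|)/|sin s|) again reduces to L, and v₈ = -8 L(π/4) (`v8_eq`). -/

/-- The real number `2 sin (2πk/r)`, so that `{k} = i · sineTwo r k`. -/
noncomputable def sineTwo (r k : ℕ) : ℝ := 2 * Real.sin (2 * Real.pi * k / r)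

/-- The product of the first `m` numbers `sineTwo r k`, `1 ≤ k ≤ m`. -/
noncomputable def sineProd (r m : ℕ) : ℝ := ∏ k ∈ Finset.Icc 1 m, sineTwo r k

lemma sineProd_zero (r : ℕ) : sineProd r 0 = 1 := by simp [sineProd]

lemma sineProd_succ (r m : ℕ) : sineProd r (m + 1) = sineProd r m * sineTwo r (m + 1) := by
  unfold sineProd
  rw [Finset.prod_Icc_succ_top (by omega)]

lemma sineProd_one (r : ℕ) : sineProd r 1 = zeta r := by
  rw [sineProd_succ, sineProd_zero]; simp [sineTwo, zeta]

lemma qInt_eq (r k : ℕ) : qInt r k = Complex.I * (sineTwo r k : ℂ) := by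
  unfold qInt root sineTwo
  rw [← Complex.exp_int_mul, ← Complex.exp_int_mul]
  push_cast
  rw [Complex.sin]
  have h1 : ((k : ℂ) * (2 * Real.pi * Complex.I / r)) = (2 * Real.pi * k / r) * Complex.I := by ring
  have h2 : (-(k : ℂ) * (2 * Real.pi * Complex.I / r)) = -(2 * Real.pi * k / r) * Complex.I := by
    ring
  rw [h1, h2]
  linear_combination (Complex.exp (2 * Real.pi * k / r * Complex.I)
    - Complex.exp (-(2 * Real.pi * k / r) * Complex.I)) * Complex.I_sq

lemma qFactorial_eq (r m : ℕ) : qFactorial r m = Complex.I ^ m * (sineProd r m : ℂ) := by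
  unfold qFactorial sineProd
  simp_rw [qInt_eq]
  rw [Finset.prod_mul_distrib, Complex.ofReal_prod]
  simp

lemma norm_qFactorial (r m : ℕ) : ‖qFactorial r m‖ = |sineProd r m| := by
  rw [qFactorial_eq]; simp

lemma sineTwo_le_two (r k : ℕ) : sineTwo r k ≤ 2 := by
  unfold sineTwo; linarith [Real.sin_le_one (2 * Real.pi * k / r)]

lemma sineTwo_pos {r k : ℕ} (hk : 1 ≤ k) (hr : 2 * k < r) : 0 < sineTwo r k := by
  unfold sineTwo
  have hr0 : (0 : ℝ) < r := by exact_mod_cast (by omega : 0 < r)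
  have hk0 : (0 : ℝ) < k := by exact_mod_cast hk
  have h : (2 * k : ℝ) < r := by exact_mod_cast hr
  have := Real.pi_pos
  refine mul_pos two_pos (Real.sin_pos_of_pos_of_lt_pi (by positivity) ?_)
  rw [div_lt_iff₀ hr0]; nlinarith

lemma sineProd_pos {r m : ℕ} (hr : 2 * m < r) : 0 < sineProd r m := by
  refine Finset.prod_pos fun k hk => ?_
  rw [Finset.mem_Icc] at hk
  exact sineTwo_pos hk.1 (by omega)

lemma sineTwo_reflect {r k : ℕ} (hr : 0 < r) (hk : k ≤ r) :
    sineTwo r (r - k) = -sineTwo r k := by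
  unfold sineTwo
  have hr0 : (r : ℝ) ≠ 0 := by exact_mod_cast hr.ne'
  rw [Nat.cast_sub hk, show 2 * Real.pi * ((r : ℝ) - k) / r = 2 * Real.pi - 2 * Real.pi * k / r by
    field_simp, Real.sin_two_pi_sub]
  ring

lemma sineProd_reflect {r : ℕ} (hr : 0 < r) {m : ℕ} (hm : m ≤ r - 1) :
    sineProd r (r - 1 - m) * ((-1) ^ m * sineProd r m) = sineProd r (r - 1) := by
  induction m with
  | zero => simp [sineProd_zero]
  | succ m ih =>
    rw [← ih (by omega), sineProd_succ, show r - 1 - m = (r - 1 - (m + 1)) + 1 by omega,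
      sineProd_succ, show r - 1 - (m + 1) + 1 = r - (m + 1) by omega,
      sineTwo_reflect hr (by omega)]
    ring

lemma sineProd_eq_zero {r m : ℕ} (hr : 0 < r) (hm : r ≤ m) : sineProd r m = 0 := by
  refine Finset.prod_eq_zero (i := r) (by rw [Finset.mem_Icc]; omega) ?_
  unfold sineTwo
  have hr0 : (r : ℝ) ≠ 0 := by exact_mod_cast hr.ne'
  rw [mul_div_assoc, div_self hr0]; simp

/-- As r is odd, ω = q² is again a primitive r-th root of unity. Since |{k}| = |1 - ω^k|, this is
the norm of ∏ (1 - ω^k) = r. -/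
lemma abs_sineProd_pred {r : ℕ} (hr : Odd r) : |sineProd r (r - 1)| = r := by
  have hr0 : r ≠ 0 := by rintro rfl; simp at hr
  obtain ⟨t, rfl⟩ : ∃ t, r = t + 1 := ⟨r - 1, by omega⟩
  have hprim : IsPrimitiveRoot (root (t + 1)) (t + 1) :=
    Complex.isPrimitiveRoot_exp (t + 1) hr0
  have hsq : IsPrimitiveRoot (root (t + 1) ^ 2) (t + 1) :=
    hprim.pow_of_coprime 2 (Nat.coprime_two_left.mpr hr)
  have hq : ‖root (t + 1)‖ = 1 := hprim.norm'_eq_one hr0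
  have hq0 : root (t + 1) ≠ 0 := hprim.ne_zero hr0
  have h := congrArg norm hsq.prod_one_sub_pow_eq_order
  have e (x : ℕ) : ‖qInt (t + 1) ((x + 1 : ℕ) : ℤ)‖ = ‖1 - (root (t + 1) ^ 2) ^ (x + 1)‖ := by
    have e1 : qInt (t + 1) ((x + 1 : ℕ) : ℤ) =
        -(root (t + 1) ^ (x + 1))⁻¹ * (1 - (root (t + 1) ^ 2) ^ (x + 1)) := by
      rw [qInt, zpow_neg, zpow_natCast, ← pow_mul, mul_comm 2, pow_mul]
      have := pow_ne_zero (x + 1) hq0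
      field_simp
      ring
    rw [e1, norm_mul, norm_neg, norm_inv, norm_pow, hq]
    simp
  rw [← norm_qFactorial, qFactorial, norm_prod, Nat.add_sub_cancel,
    show Finset.Icc 1 t = Finset.Ico (0 + 1) (t + 1) by ext; simp,
    ← Finset.prod_Ico_add' (fun x : ℕ => ‖qInt (t + 1) x‖), ← Finset.range_eq_Ico]
  rw [norm_prod] at h
  simp_rw [e, h]
  rw [← Nat.cast_succ, Complex.norm_natCast]

/-- The difference of sines is a multiple of sin(π(b-a)/r) cos(π(a+b)/r). A condition on a + b
rather than on b is needed: b = N can lie just past the maximum of the sine at r/4. -/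
lemma sineTwo_le_sineTwo {r a b : ℕ} (hr : 0 < r) (hab : a ≤ b) (h : 2 * (a + b) ≤ r) :
    sineTwo r a ≤ sineTwo r b := by
  unfold sineTwo
  have hr0 : (0 : ℝ) < r := by exact_mod_cast hr
  have hab' : (a : ℝ) ≤ b := by exact_mod_cast hab
  have h' : 2 * ((a : ℝ) + b) ≤ r := by exact_mod_cast h
  have ha0 : (0 : ℝ) ≤ a := a.cast_nonneg
  have hpi := Real.pi_pos
  have e := Real.sin_sub_sin (2 * Real.pi * b / r) (2 * Real.pi * a / r)
  have e1 : 0 ≤ Real.sin ((2 * Real.pi * b / r - 2 * Real.pi * a / r) / 2) := by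
    rw [show (2 * Real.pi * b / r - 2 * Real.pi * a / r) / 2 = Real.pi * (b - a) / r by ring]
    apply Real.sin_nonneg_of_nonneg_of_le_pi
    · exact div_nonneg (mul_nonneg hpi.le (by linarith)) hr0.le
    · rw [div_le_iff₀ hr0]; nlinarith
  have e2 : 0 ≤ Real.cos ((2 * Real.pi * b / r + 2 * Real.pi * a / r) / 2) := by
    rw [show (2 * Real.pi * b / r + 2 * Real.pi * a / r) / 2 = Real.pi * (b + a) / r by ring]
    apply Real.cos_nonneg_of_neg_pi_div_two_le_of_le
    · have : 0 ≤ Real.pi * (b + a) / r := by positivity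
      linarith
    · rw [div_le_iff₀ hr0]; nlinarith
  nlinarith [mul_nonneg e1 e2]

/-- Moving j to j + 1 multiplies the product by `sineTwo r (j + 1) / sineTwo r (N - j)`, which is at
most 1 below the middle. The induction is on the distance i from j to the middle. -/
lemma sineProd_mul_min_aux {r N : ℕ} (hr : 2 * (N + 1) ≤ r) (i : ℕ) :
    ∀ j, j + i = N / 2 → sineProd r (N / 2) * sineProd r (N - N / 2) ≤
      sineProd r j * sineProd r (N - j) := by
  induction i with
  | zero => rintro j h; simp only [add_zero] at h; rw [h]
  | succ i ih =>
    intro j h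
    refine (ih (j + 1) (by omega)).trans ?_
    rw [show N - j = (N - (j + 1)) + 1 by omega, sineProd_succ, sineProd_succ]
    have h1 := sineProd_pos (r := r) (m := j) (by omega)
    have h2 := sineProd_pos (r := r) (m := N - (j + 1)) (by omega)
    have h3 : sineTwo r (j + 1) ≤ sineTwo r (N - (j + 1) + 1) :=
      sineTwo_le_sineTwo (by omega) (by omega) (by omega)
    nlinarith [mul_le_mul_of_nonneg_left h3 (mul_pos h1 h2).le]

lemma sineProd_mul_min {r N : ℕ} (hr : 2 * (N + 1) ≤ r) {j : ℕ} (hj : j ≤ N) :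
    sineProd r (N / 2) * sineProd r (N - N / 2) ≤ sineProd r j * sineProd r (N - j) := by
  rcases le_total j (N / 2) with h | h
  · exact sineProd_mul_min_aux hr (N / 2 - j) j (by omega)
  · rcases eq_or_lt_of_le h with h | h
    · rw [h]
    · have := sineProd_mul_min_aux hr (N / 2 - (N - j)) (N - j) (by omega)
      rwa [show N - (N - j) = j by omega, mul_comm (sineProd r (N - j))] at this

lemma sineProd_add_le {r m d : ℕ} (hr : 2 * (m + d) < r) :
    sineProd r (m + d) ≤ sineProd r m * 2 ^ d := by
  induction d with
  | zero => simp
  | succ d ih =>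
    rw [← add_assoc, sineProd_succ, pow_succ, ← mul_assoc]
    exact mul_le_mul (ih (by omega)) (sineTwo_le_two _ _) (sineTwo_pos (by omega) (by omega)).le
      (mul_nonneg (sineProd_pos (by omega)).le (by positivity))

/-! ### The absolute value of the `6j`-symbol -/

/-- Squaring removes the choice of root; the symbol only needs the fourth power of this norm. -/
lemma norm_Delta_sq {r : ℕ} (a b c : ℕ) :
    ‖Delta r a b c‖ ^ 2 = |zeta r| * (|sineProd r ((a + b - c) / 2)| *
      |sineProd r ((a + c - b) / 2)| * |sineProd r ((b + c - a) / 2)|) /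
        |sineProd r ((a + b + c) / 2 + 1)| := by
  rw [← norm_pow, Delta, show (1 / 2 : ℂ) = ((2 : ℕ) : ℂ)⁻¹ by norm_num,
    Complex.cpow_nat_inv_pow _ two_ne_zero]
  simp [norm_qFactorial]

/-- The absolute value of the summand of `z = 4N - j` in the `6j`-symbol of colors `2N`. -/
noncomputable def summand (r N j : ℕ) : ℝ :=
  |sineProd r (4 * N - j + 1)| / (|sineProd r (N - j)| ^ 4 * |sineProd r j| ^ 3)

lemma sum_eq {r N : ℕ} (hr : Odd r) (h : 4 * N ≤ r + 1) (h' : r ≤ 4 * N + 1) (h2 : 2 ≤ N) :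
    ‖∑ z ∈ Finset.Icc (3 * N) (4 * N), (-1 : ℂ) ^ z * qFactorial r (z + 1) /
        ((qFactorial r (z - 3 * N) * qFactorial r (z - 3 * N) * qFactorial r (z - 3 * N) *
            qFactorial r (z - 3 * N)) *
          (qFactorial r (4 * N - z) * qFactorial r (4 * N - z) * qFactorial r (4 * N - z)))‖ =
      ∑ j ∈ Finset.range (N + 1), summand r N j := by
  -- σ is the sign of S(r-1). By reflection it is the sign of (-1)^m S(m) whenever S(r-1-m) > 0; for
  -- m ≥ r both sides vanish.
  obtain ⟨σ, hσ, hσ'⟩ : ∃ σ : ℂ, ‖σ‖ = 1 ∧ ∀ m, 2 * (r - 1 - m) < r →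
      ((-1) ^ m * sineProd r m : ℂ) = σ * |sineProd r m| := by
    have hr0 : 0 < r := hr.pos
    refine ⟨((SignType.sign (sineProd r (r - 1)) : ℝ) : ℂ), ?_, fun m hm => ?_⟩
    · have h1 : sineProd r (r - 1) ≠ 0 := by
        rw [← abs_pos, abs_sineProd_pred hr]; exact_mod_cast hr0
      rcases lt_or_gt_of_ne h1 with h | h <;> simp [h]
    · rcases le_or_gt r m with h | h
      · simp [sineProd_eq_zero hr0 h]
      · have h1 := sineProd_reflect hr0 (m := m) (by omega)
        have h2 : 0 < sineProd r (r - 1 - m) := sineProd_pos hm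
        have h3 : |(-1) ^ m * sineProd r m| = |sineProd r m| := by simp [abs_mul]
        rw [← h3, ← h1, sign_mul, sign_pos h2, one_mul]
        rw [← Complex.ofReal_mul, sign_mul_abs]
        push_cast
        rfl
  -- The phase is independent of z: the fourth power contributes 1, and dividing by the cube of
  -- i^(4N-z) is multiplying by i^(4N-z), which completes i^(z+1) to i^(4N+1).
  have key : ∀ z ∈ Finset.Icc (3 * N) (4 * N), (-1 : ℂ) ^ z * qFactorial r (z + 1) /
        ((qFactorial r (z - 3 * N) * qFactorial r (z - 3 * N) * qFactorial r (z - 3 * N) *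
            qFactorial r (z - 3 * N)) *
          (qFactorial r (4 * N - z) * qFactorial r (4 * N - z) * qFactorial r (4 * N - z))) =
      -(σ * Complex.I ^ (4 * N + 1)) * (summand r N (4 * N - z) : ℝ) := by
    intro z hz
    rw [Finset.mem_Icc] at hz
    have h1 := hσ' (z + 1) (by omega)
    have h3 : 0 < sineProd r (z - 3 * N) := sineProd_pos (by omega)
    have h4 : 0 < sineProd r (4 * N - z) := sineProd_pos (by omega)
    simp only [qFactorial_eq, summand]
    rw [show 4 * N - (4 * N - z) + 1 = z + 1 by omega, show N - (4 * N - z) = z - 3 * N by omega,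
      abs_of_pos h3, abs_of_pos h4]
    push_cast
    have h3' : (sineProd r (z - 3 * N) : ℂ) ≠ 0 := by exact_mod_cast h3.ne'
    have h4' : (sineProd r (4 * N - z) : ℂ) ≠ 0 := by exact_mod_cast h4.ne'
    have hI := Complex.I_ne_zero
    have e1 : Complex.I ^ (4 * N + 1) = Complex.I ^ (z + 1) * Complex.I ^ (4 * N - z) := by
      rw [← pow_add]; congr 1; omega
    have e2 : (Complex.I ^ (z - 3 * N)) ^ 4 = 1 := by
      rw [← pow_mul, mul_comm, pow_mul]; simp
    have e3 : (Complex.I ^ (4 * N - z)) ^ 4 = 1 := by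
      rw [← pow_mul, mul_comm, pow_mul]; simp
    have h5 := pow_ne_zero (z - 3 * N) hI
    have h6 := pow_ne_zero (4 * N - z) hI
    rw [e1]
    rw [div_eq_iff (by positivity)]
    generalize Complex.I ^ (z - 3 * N) = x at *
    generalize Complex.I ^ (4 * N - z) = y at *
    generalize (sineProd r (z - 3 * N) : ℂ) = A at *
    generalize (sineProd r (4 * N - z) : ℂ) = B at *
    have : (-1 : ℂ) ^ z * sineProd r (z + 1) = -(σ * |sineProd r (z + 1)|) := by
      rw [← h1]; ring
    field_simp
    linear_combination this + σ * (|sineProd r (z + 1)| : ℝ) * (x ^ 4 * e3 + e2)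
  rw [Finset.sum_congr rfl key, ← Finset.mul_sum, ← Complex.ofReal_sum, norm_mul]
  have : ∀ j, 0 ≤ summand r N j := fun j => by unfold summand; positivity
  rw [Complex.norm_of_nonneg (Finset.sum_nonneg fun _ _ => this _)]
  simp only [norm_neg, norm_mul, hσ, norm_pow, Complex.norm_I, one_pow, mul_one, one_mul]
  refine Finset.sum_bij' (fun z _ => 4 * N - z) (fun j _ => 4 * N - j) ?_ ?_ ?_ ?_ ?_
  all_goals intro a ha
  all_goals simp only [Finset.mem_Icc, Finset.mem_range] at *
  all_goals omega

lemma norm_sixJ {r N : ℕ} (hr : Odd r) (h : 4 * N ≤ r + 1) (h' : r ≤ 4 * N + 1) (h2 : 2 ≤ N) :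
    ‖sixJ r (2 * N) (2 * N) (2 * N) (2 * N) (2 * N) (2 * N)‖ =
      |zeta r| * |sineProd r N| ^ 6 / |sineProd r (3 * N + 1)| ^ 2 *
        ∑ j ∈ Finset.range (N + 1), summand r N j := by
  have hz : |zeta r| ≠ 0 := by
    rw [← sineProd_one, abs_ne_zero]
    exact (sineProd_pos (by omega)).ne'
  unfold sixJ
  have e1 : (2 * N + 2 * N + 2 * N) / 2 = 3 * N := by omega
  have e2 : (2 * N + 2 * N + 2 * N + 2 * N) / 2 = 4 * N := by omega
  have e3 : (2 * N + 2 * N - 2 * N) / 2 = N := by omega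
  simp only [e1, e2, max_self, min_self, norm_mul, sum_eq hr h h' h2, norm_inv, norm_pow,
    Complex.norm_I, one_pow, mul_one, Complex.norm_real, Real.norm_eq_abs]
  congr 1
  have hD := norm_Delta_sq (r := r) (2 * N) (2 * N) (2 * N)
  rw [e1, e3] at hD
  have : ∀ x : ℝ, x * x * x * x = (x ^ 2) ^ 2 := fun x => by ring
  rw [this, hD]
  field_simp

/-! ### Two-sided bounds for the sum -/

lemma summand_eq {r N d j : ℕ} (hr : Odd r) (hd : r + d = 4 * N + 2) (hd1 : d ≤ 3) (h2 : 3 ≤ N)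
    (hj : d ≤ j) (hj' : j ≤ N) :
    summand r N j =
      r / (sineProd r (j - d) * sineProd r (N - j) ^ 4 * sineProd r j ^ 3) := by
  have h1 : 0 < sineProd r (j - d) := sineProd_pos (by omega)
  have h3 : 0 < sineProd r (N - j) := sineProd_pos (by omega)
  have h4 : 0 < sineProd r j := sineProd_pos (by omega)
  have h5 := congrArg abs (sineProd_reflect hr.pos (m := 4 * N - j + 1) (by omega))
  rw [abs_sineProd_pred hr, abs_mul, abs_mul, abs_pow, abs_neg, abs_one, one_pow, one_mul,
    show r - 1 - (4 * N - j + 1) = j - d by omega, abs_of_pos h1] at h5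
  rw [summand, abs_of_pos h3, abs_of_pos h4, ← h5]
  field_simp

lemma sum_summand_le {r N d : ℕ} (hr : Odd r) (hd : r + d = 4 * N + 2) (hd1 : d ≤ 3)
    (h2 : 4 ≤ N) :
    ∑ j ∈ Finset.range (N + 1), summand r N j ≤
      (N + 1) * (8 * (r / (sineProd r (N / 2) * sineProd r (N - N / 2)) ^ 4)) := by
  have h1 : 0 < sineProd r (N / 2) := sineProd_pos (by omega)
  have h3 : 0 < sineProd r (N - N / 2) := sineProd_pos (by omega)
  have := Finset.sum_le_card_nsmul (Finset.range (N + 1)) (summand r N)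
    (8 * (r / (sineProd r (N / 2) * sineProd r (N - N / 2)) ^ 4)) ?_
  · simpa using this
  intro j hj
  rw [Finset.mem_range] at hj
  -- For j < d the numerator contains the factor {r} = 0. Otherwise S(j) ≤ 2^d S(j-d), and d ≤ 3
  -- gives the constant 8.
  rcases lt_or_ge j d with h | h
  · rw [summand, sineProd_eq_zero hr.pos (by omega)]
    simp only [abs_zero, zero_div]
    positivity
  · rw [summand_eq hr hd hd1 (by omega) h (by omega)]
    have h4 : 0 < sineProd r (j - d) := sineProd_pos (by omega)
    have h5 : 0 < sineProd r (N - j) := sineProd_pos (by omega)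
    have h6 : 0 < sineProd r j := sineProd_pos (by omega)
    have h7 := sineProd_mul_min (r := r) (N := N) (by omega) (j := j) (by omega)
    have h8 : sineProd r j ≤ sineProd r (j - d) * 8 := by
      have := sineProd_add_le (r := r) (m := j - d) (d := d) (by omega)
      rw [Nat.sub_add_cancel h] at this
      have h9 : (2 : ℝ) ^ d ≤ 2 ^ 3 := pow_le_pow_right₀ (by norm_num) hd1
      nlinarith
    rw [← mul_div_assoc, div_le_div_iff₀ (by positivity) (by positivity)]
    have h10 := pow_le_pow_left₀ (by positivity) h7 4
    calc (r : ℝ) * (sineProd r (N / 2) * sineProd r (N - N / 2)) ^ 4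
        ≤ r * (sineProd r j * sineProd r (N - j)) ^ 4 := by gcongr
      _ = r * (sineProd r j * (sineProd r (N - j) ^ 4 * sineProd r j ^ 3)) := by ring
      _ ≤ r * (sineProd r (j - d) * 8 * (sineProd r (N - j) ^ 4 * sineProd r j ^ 3)) := by gcongr
      _ = _ := by ring

lemma le_sum_summand {r N d : ℕ} (hr : Odd r) (hd : r + d = 4 * N + 2) (hd1 : d ≤ 3)
    (h2 : 6 ≤ N) :
    r / (sineProd r (N / 2 - d) * sineProd r (N - N / 2) ^ 4 * sineProd r (N / 2) ^ 3) ≤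
      ∑ j ∈ Finset.range (N + 1), summand r N j := by
  rw [← summand_eq hr hd hd1 (by omega) (by omega) (by omega)]
  exact Finset.single_le_sum (f := summand r N) (fun j _ => by unfold summand; positivity)
    (Finset.mem_range.mpr (by omega))

lemma abs_sineProd_three_mul {r N d : ℕ} (hr : Odd r) (hd : r + d = 4 * N + 2) (h2 : 3 ≤ N)
    (hd1 : d ≤ 3) :
    |sineProd r (3 * N + 1)| = r / sineProd r (N - d) := by
  have h1 : 0 < sineProd r (N - d) := sineProd_pos (by omega)
  have h5 := congrArg abs (sineProd_reflect hr.pos (m := 3 * N + 1) (by omega))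
  rw [abs_sineProd_pred hr, abs_mul, abs_mul, abs_pow, abs_neg, abs_one, one_pow, one_mul,
    show r - 1 - (3 * N + 1) = N - d by omega, abs_of_pos h1] at h5
  rw [← h5]
  field_simp

/-! ### Growth of quantum factorials -/

lemma intervalIntegrable_log_two_sin (a b : ℝ) :
    IntervalIntegrable (fun t => Real.log (2 * Real.sin t)) MeasureTheory.volume a b := by
  have : AnalyticOnNhd ℝ (fun t => 2 * Real.sin t) Set.univ :=
    fun x _ => analyticAt_const.mul (Real.analyticAt_sin)
  exact MeromorphicOn.intervalIntegrable_log (f := fun t => 2 * Real.sin t)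
    (fun x _ => (this x trivial).meromorphicAt)

/-- The primitive of `log (2 sin t)`; it is the opposite of the Lobachevsky function. -/
noncomputable def logSinPrim (x : ℝ) : ℝ := ∫ t in 0..x, Real.log (2 * Real.sin t)

lemma continuous_logSinPrim : Continuous logSinPrim :=
  intervalIntegral.continuous_primitive intervalIntegrable_log_two_sin 0

lemma logSinPrim_sub (a b : ℝ) :
    logSinPrim b - logSinPrim a = ∫ t in a..b, Real.log (2 * Real.sin t) :=
  intervalIntegral.integral_interval_sub_left (intervalIntegrable_log_two_sin _ _)
    (intervalIntegrable_log_two_sin _ _)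

lemma log_two_sin_mono {s t : ℝ} (hs : 0 < s) (hst : s ≤ t) (ht : t ≤ Real.pi / 2) :
    Real.log (2 * Real.sin s) ≤ Real.log (2 * Real.sin t) := by
  have h1 : 0 < Real.sin s := Real.sin_pos_of_pos_of_lt_pi hs (by linarith [Real.pi_pos])
  have h2 := Real.sin_le_sin_of_le_of_le_pi_div_two (by linarith [Real.pi_pos]) ht hst
  exact Real.log_le_log (by positivity) (by linarith)

lemma logSinPrim_sub_le {a b : ℝ} (ha : 0 ≤ a) (hab : a ≤ b) (hb : b ≤ Real.pi / 2) :
    logSinPrim b - logSinPrim a ≤ (b - a) * Real.log (2 * Real.sin b) := by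
  rw [logSinPrim_sub, ← smul_eq_mul, ← intervalIntegral.integral_const]
  refine intervalIntegral.integral_mono_on_of_le_Ioo hab (intervalIntegrable_log_two_sin _ _)
    intervalIntegrable_const fun x hx => ?_
  exact log_two_sin_mono (by linarith [hx.1]) hx.2.le hb

/-- Here a must be positive: with `Real.log 0 = 0` the bound fails at a = 0, so the upper Riemann
estimate has to leave out the first interval. -/
lemma le_logSinPrim_sub {a b : ℝ} (ha : 0 < a) (hab : a ≤ b) (hb : b ≤ Real.pi / 2) :
    (b - a) * Real.log (2 * Real.sin a) ≤ logSinPrim b - logSinPrim a := by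
  rw [logSinPrim_sub, ← smul_eq_mul, ← intervalIntegral.integral_const]
  refine intervalIntegral.integral_mono_on_of_le_Ioo hab intervalIntegrable_const
    (intervalIntegrable_log_two_sin _ _) fun x hx => ?_
  exact log_two_sin_mono ha hx.1.le (by linarith [hx.2])

lemma logSinPrim_zero : logSinPrim 0 = 0 := by simp [logSinPrim]

lemma log_sineProd_succ {r m : ℕ} (hr : 2 * (m + 1) < r) :
    Real.log (sineProd r (m + 1)) = Real.log (sineProd r m) +
      Real.log (2 * Real.sin ((m + 1 : ℕ) * (2 * Real.pi / r))) := by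
  rw [sineProd_succ, Real.log_mul (sineProd_pos (by omega)).ne'
    (sineTwo_pos (by omega) (by omega)).ne', sineTwo]
  congr 4
  ring

lemma mul_two_pi_div_le {r m : ℕ} (hr : 0 < r) (h : 4 * m ≤ r) :
    m * (2 * Real.pi / r) ≤ Real.pi / 2 := by
  have hr0 : (0 : ℝ) < r := by exact_mod_cast hr
  have h' : (4 * m : ℝ) ≤ r := by exact_mod_cast h
  rw [mul_div_assoc', div_le_div_iff₀ hr0 two_pos]
  nlinarith [Real.pi_pos]

lemma logSinPrim_le_log_sineProd {r m : ℕ} (hr : 0 < r) (h : 4 * m ≤ r) :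
    logSinPrim (m * (2 * Real.pi / r)) ≤ 2 * Real.pi / r * Real.log (sineProd r m) := by
  have hh : 0 < 2 * Real.pi / r := by have := Real.pi_pos; positivity
  induction m with
  | zero => simp [sineProd_zero, logSinPrim_zero]
  | succ m ih =>
    have ih := ih (by omega)
    rw [log_sineProd_succ (by omega), mul_add]
    have := logSinPrim_sub_le (a := m * (2 * Real.pi / r)) (b := (m + 1 : ℕ) * (2 * Real.pi / r))
      (by positivity) (by push_cast; nlinarith) (mul_two_pi_div_le hr h)
    have e : ((m + 1 : ℕ) * (2 * Real.pi / r) - m * (2 * Real.pi / r)) = 2 * Real.pi / r := by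
      push_cast; ring
    rw [e] at this
    linarith

/-- Each term but the last is compared with the integral over the interval to its right; the last is
kept as it stands. -/
lemma log_sineProd_le_aux {r m : ℕ} (hr : 0 < r) (h : 4 * (m + 1) ≤ r) :
    2 * Real.pi / r * Real.log (sineProd r (m + 1)) ≤
      logSinPrim ((m + 1 : ℕ) * (2 * Real.pi / r)) - logSinPrim (2 * Real.pi / r) +
        2 * Real.pi / r * Real.log (2 * Real.sin ((m + 1 : ℕ) * (2 * Real.pi / r))) := by
  have hh : 0 < 2 * Real.pi / r := by have := Real.pi_pos; positivity
  induction m with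
  | zero => simp [sineProd_one, zeta]
  | succ m ih =>
    have ih := ih (by omega)
    rw [log_sineProd_succ (by omega), mul_add]
    have := le_logSinPrim_sub (a := (m + 1 : ℕ) * (2 * Real.pi / r))
      (b := (m + 1 + 1 : ℕ) * (2 * Real.pi / r))
      (by positivity) (by push_cast; nlinarith) (mul_two_pi_div_le hr h)
    have e : ((m + 1 + 1 : ℕ) * (2 * Real.pi / r) - (m + 1 : ℕ) * (2 * Real.pi / r)) =
        2 * Real.pi / r := by
      push_cast; ring
    rw [e] at this
    linarith

lemma log_two_sin_le {x : ℝ} (hx : 0 < x) (hx' : x ≤ Real.pi / 2) :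
    Real.log (2 * Real.sin x) ≤ Real.log 2 := by
  simpa using log_two_sin_mono hx hx' le_rfl

lemma log_sineProd_le {r m : ℕ} (hr : 4 ≤ r) (h : 4 * m ≤ r) :
    2 * Real.pi / r * Real.log (sineProd r m) ≤
      logSinPrim (m * (2 * Real.pi / r)) - logSinPrim (2 * Real.pi / r) +
        2 * Real.pi / r * Real.log 2 := by
  have hr' : 0 < r := by omega
  have hh : 0 < 2 * Real.pi / r := by have := Real.pi_pos; positivity
  rcases m with _ | m
  · have h1 := mul_two_pi_div_le (r := r) (m := 1) (by omega) (by omega)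
    rw [Nat.cast_one, one_mul] at h1
    have h2 := logSinPrim_sub_le le_rfl hh.le h1
    have h3 := mul_le_mul_of_nonneg_left (log_two_sin_le hh h1) hh.le
    simp only [logSinPrim_zero, sub_zero] at h2
    simp only [sineProd_zero, Real.log_one, mul_zero, Nat.cast_zero, zero_mul, logSinPrim_zero]
    linarith
  · refine (log_sineProd_le_aux (by omega) h).trans ?_
    gcongr _ + _ * ?_
    exact log_two_sin_le (by positivity) (mul_two_pi_div_le (by omega) h)

open Filter

lemma tendsto_two_pi_div {l : Filter ℕ} (hl : l ≤ atTop) :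
    Tendsto (fun r : ℕ => 2 * Real.pi / (r : ℝ)) l (𝓝 0) :=
  (tendsto_const_div_atTop_nhds_zero_nat (2 * Real.pi)).mono_left hl

/-- The gap between the two Riemann bounds is -L(h) + h log 2 with h = 2π/r, and tends to 0 by
continuity of L. The condition 4m ≤ r keeps the points where log(2 sin t) is increasing. -/
lemma tendsto_log_sineProd {l : Filter ℕ} (hl : l ≤ atTop) {m : ℕ → ℕ} {c : ℝ}
    (hm : Tendsto (fun r : ℕ => (m r : ℝ) / r) l (𝓝 c)) (hm' : ∀ᶠ r in l, 4 * m r ≤ r) :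
    Tendsto (fun r : ℕ => 2 * Real.pi / (r : ℝ) * Real.log (sineProd r (m r))) l
      (𝓝 (logSinPrim (2 * Real.pi * c))) := by
  have hh := tendsto_two_pi_div hl
  have h1 : Tendsto (fun r : ℕ => logSinPrim (m r * (2 * Real.pi / r))) l
      (𝓝 (logSinPrim (2 * Real.pi * c))) := by
    refine (continuous_logSinPrim.tendsto _).comp ((hm.const_mul (2 * Real.pi)).congr fun r => ?_)
    ring
  have h2 := (h1.sub ((continuous_logSinPrim.tendsto _).comp hh)).add
    (hh.mul_const (Real.log 2))
  simp only [logSinPrim_zero, sub_zero, zero_mul, add_zero] at h2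
  refine tendsto_of_tendsto_of_tendsto_of_le_of_le' h1 h2 ?_ ?_
  · filter_upwards [hm', hl (eventually_ge_atTop 4)] with r hr hr4
    exact logSinPrim_le_log_sineProd (by omega) hr
  · filter_upwards [hm', hl (eventually_ge_atTop 4)] with r hr hr4
    exact log_sineProd_le hr4 hr

lemma tendsto_log_nat {l : Filter ℕ} (hl : l ≤ atTop) :
    Tendsto (fun r : ℕ => 2 * Real.pi / (r : ℝ) * Real.log r) l (𝓝 0) := by
  have h := (Real.isLittleO_log_id_atTop.tendsto_div_nhds_zero.comp
    tendsto_natCast_atTop_atTop).mono_left hl |>.const_mul (2 * Real.pi)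
  rw [mul_zero] at h
  refine h.congr fun r => ?_
  simp only [Function.comp, id]
  ring

end QuantumSixJ

namespace QuantumSixJ

/-! ### The volume of the regular ideal octahedron -/

open MeasureTheory Set

lemma idealOctahedron_eq :
    idealOctahedron = {x : EuclideanSpace ℝ (Fin 3) | |x 0| + |x 1| + |x 2| ≤ 1} := by
  apply Subset.antisymm
  · refine convexHull_min ?_ ?_
    · rintro _ ⟨i, rfl | rfl⟩ <;> fin_cases i <;> simp
    · intro x hx y hy a b ha hb hab
      simp only [mem_ofPred_eq, PiLp.add_apply, PiLp.smul_apply, smul_eq_mul] at *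
      have h (i : Fin 3) : |a * x i + b * y i| ≤ a * |x i| + b * |y i| := by
        refine (abs_add_le _ _).trans ?_
        rw [abs_mul, abs_mul, abs_of_nonneg ha, abs_of_nonneg hb]
      nlinarith [h 0, h 1, h 2]
  · intro x hx
    rw [mem_ofPred_eq] at hx
    let V : Set (EuclideanSpace ℝ (Fin 3)) :=
      {v | ∃ i, v = EuclideanSpace.single i 1 ∨ v = -EuclideanSpace.single i 1}
    let p (i : Fin 3) : EuclideanSpace ℝ (Fin 3) :=
      if 0 ≤ x i then EuclideanSpace.single i 1 else -EuclideanSpace.single i 1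
    have hV : Convex ℝ idealOctahedron := convex_convexHull ℝ V
    have hsub : V ⊆ idealOctahedron := subset_convexHull ℝ V
    have hp : ∀ i, p i ∈ idealOctahedron := by
      intro i
      apply hsub
      by_cases h : 0 ≤ x i
      · exact ⟨i, Or.inl (by simp [p, h])⟩
      · exact ⟨i, Or.inr (by simp [p, h])⟩
    have h0 : (0 : EuclideanSpace ℝ (Fin 3)) ∈ idealOctahedron := by
      have := hV (hsub ⟨0, Or.inl rfl⟩) (hsub ⟨0, Or.inr rfl⟩) (a := 1 / 2) (b := 1 / 2)
        (by norm_num) (by norm_num) (by norm_num)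
      simpa using this
    -- The point is a convex combination of the vertices sign(x_i) e_i with weights |x_i|, the
    -- origin taking up the remaining weight.
    have hsum := hV.sum_mem (t := Finset.univ)
      (w := Fin.cons (1 - (|x 0| + |x 1| + |x 2|)) fun i : Fin 3 => |x i|)
      (z := Fin.cons 0 p) ?_ ?_ ?_
    · convert hsum
      rw [Fin.sum_univ_succ]
      simp only [Fin.cons_zero, Fin.cons_succ, smul_zero, zero_add]
      have e (i : Fin 3) : |x i| • p i = EuclideanSpace.single i (x i) := by
        by_cases h : 0 ≤ x i
        · ext j; simp [p, h, abs_of_nonneg]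
        · ext j; simp [p, h, abs_of_neg (not_le.mp h)]
      simp_rw [e]
      ext j
      fin_cases j <;> simp [Fin.sum_univ_three]
    · intro i _
      refine Fin.cases ?_ (fun i => ?_) i
      · simp only [Fin.cons_zero]; linarith
      · simp
    · rw [Fin.sum_univ_succ, Fin.sum_univ_three]
      simp only [Fin.cons_zero, Fin.cons_succ]
      ring
    · intro i _
      refine Fin.cases ?_ (fun i => ?_) i
      · simpa using h0
      · simpa using hp i

/-- The hyperbolic density on the ideal octahedron, in coordinates, extended by zero. -/
noncomputable def octDensity (x y z : ℝ) : ENNReal :=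
  if |x| + |y| + |z| ≤ 1 ∧ x ^ 2 + y ^ 2 + z ^ 2 < 1 then
    ENNReal.ofReal (((1 - (x ^ 2 + y ^ 2 + z ^ 2)) ^ 2)⁻¹) else 0

lemma measurable_octDensity :
    Measurable fun p : ℝ × ℝ × ℝ => octDensity p.1 p.2.1 p.2.2 := by
  unfold octDensity
  have h1 : Measurable fun p : ℝ × ℝ × ℝ => |p.1| + |p.2.1| + |p.2.2| :=
    Continuous.measurable (by fun_prop)
  have h2 : Measurable fun p : ℝ × ℝ × ℝ => p.1 ^ 2 + p.2.1 ^ 2 + p.2.2 ^ 2 := by fun_prop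
  exact Measurable.ite ((measurableSet_le h1 measurable_const).inter
    (measurableSet_lt h2 measurable_const)) (by fun_prop) measurable_const

lemma hyperbolicVolume_eq_lintegral :
    hyperbolicVolume idealOctahedron =
      ∫⁻ x : EuclideanSpace ℝ (Fin 3), octDensity (x 0) (x 1) (x 2) := by
  have hm : MeasurableSet idealOctahedron := by
    rw [idealOctahedron_eq]
    exact measurableSet_le (by fun_prop) measurable_const
  rw [hyperbolicVolume, withDensity_apply _ hm, Measure.restrict_restrict hm,
    ← lintegral_indicator (hm.inter measurableSet_ball)]
  congr 1
  ext x
  have hx : ‖x‖ ^ 2 = x 0 ^ 2 + x 1 ^ 2 + x 2 ^ 2 := by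
    rw [EuclideanSpace.real_norm_sq_eq, Fin.sum_univ_three]
  have hx' : ‖x‖ < 1 ↔ x 0 ^ 2 + x 1 ^ 2 + x 2 ^ 2 < 1 := by
    rw [← hx, sq_lt_one_iff₀ (norm_nonneg _)]
  simp only [indicator, octDensity, idealOctahedron_eq, mem_inter_iff, mem_ofPred_eq,
    mem_ball_zero_iff, hx', hx]

lemma lintegral_octDensity :
    ∫⁻ x : EuclideanSpace ℝ (Fin 3), octDensity (x 0) (x 1) (x 2) =
      ∫⁻ z : ℝ, ∫⁻ p : ℝ × ℝ, octDensity p.1 p.2 z := by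
  have hF : Measurable fun p : Fin 3 → ℝ => octDensity (p 0) (p 1) (p 2) :=
    measurable_octDensity.comp (g := fun p : ℝ × ℝ × ℝ => octDensity p.1 p.2.1 p.2.2)
      (f := fun p : Fin 3 → ℝ => (p 0, p 1, p 2)) (by fun_prop)
  have hH : Measurable fun p : ℝ × (Fin 2 → ℝ) => octDensity (p.2 0) (p.2 1) p.1 :=
    measurable_octDensity.comp (g := fun p : ℝ × ℝ × ℝ => octDensity p.1 p.2.1 p.2.2)
      (f := fun p : ℝ × (Fin 2 → ℝ) => (p.2 0, p.2 1, p.1)) (by fun_prop)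
  have h1 := (PiLp.volume_preserving_ofLp (Fin 3)).lintegral_comp hF
  have h2 := (volume_preserving_piFinSuccAbove (fun _ : Fin 3 => ℝ) 2).lintegral_comp hH
  refine h1.trans (Eq.trans ?_ (h2.trans ?_))
  · rfl
  · rw [Measure.volume_eq_prod, lintegral_prod _ hH.aemeasurable]
    congr 1
    ext z
    have hG : Measurable fun p : ℝ × ℝ => octDensity p.1 p.2 z :=
      measurable_octDensity.comp (g := fun p : ℝ × ℝ × ℝ => octDensity p.1 p.2.1 p.2.2)
        (f := fun p : ℝ × ℝ => (p.1, p.2, z)) (by fun_prop)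
    exact (volume_preserving_finTwoArrow ℝ).lintegral_comp hG

lemma measurable_octDensity_polar :
    Measurable fun p : (ℝ × ℝ) × ℝ => ENNReal.ofReal p.2 *
      octDensity (p.2 * Real.cos p.1.2) (p.2 * Real.sin p.1.2) p.1.1 :=
  (by fun_prop : Measurable fun p : (ℝ × ℝ) × ℝ => ENNReal.ofReal p.2).mul
    (measurable_octDensity.comp (g := fun p : ℝ × ℝ × ℝ => octDensity p.1 p.2.1 p.2.2)
      (f := fun p : (ℝ × ℝ) × ℝ => (p.2 * Real.cos p.1.2, p.2 * Real.sin p.1.2, p.1.1))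
      (by fun_prop))

lemma lintegral_octDensity_polar :
    ∫⁻ z : ℝ, ∫⁻ p : ℝ × ℝ, octDensity p.1 p.2 z =
      ∫⁻ φ in Ioo (-Real.pi) Real.pi, ∫⁻ z : ℝ, ∫⁻ ρ in Ioi 0,
        ENNReal.ofReal ρ * octDensity (ρ * Real.cos φ) (ρ * Real.sin φ) z := by
  have h1 (z : ℝ) : ∫⁻ p : ℝ × ℝ, octDensity p.1 p.2 z =
      ∫⁻ φ in Ioo (-Real.pi) Real.pi, ∫⁻ ρ in Ioi 0,
        ENNReal.ofReal ρ * octDensity (ρ * Real.cos φ) (ρ * Real.sin φ) z := by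
    rw [← lintegral_comp_polarCoord_symm, polarCoord_target, Measure.volume_eq_prod,
      ← Measure.prod_restrict, lintegral_prod_symm]
    · rfl
    · exact (measurable_octDensity_polar.comp (by fun_prop :
        Measurable fun p : ℝ × ℝ => ((z, p.2), p.1))).aemeasurable
  simp_rw [h1]
  rw [lintegral_lintegral_swap]
  exact (measurable_octDensity_polar.lintegral_prod_right' (ν := volume.restrict (Ioi 0))).aemeasurable

lemma lintegral_Ioc_ofReal {f : ℝ → ℝ} {a b : ℝ} (hab : a ≤ b) (hf : ContinuousOn f (Icc a b))
    (h0 : ∀ x ∈ Icc a b, 0 ≤ f x) :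
    ∫⁻ x in Ioc a b, ENNReal.ofReal (f x) = ENNReal.ofReal (∫ x in a..b, f x) := by
  rw [intervalIntegral.integral_of_le hab, ofReal_integral_eq_lintegral_ofReal]
  · exact (hf.integrableOn_compact isCompact_Icc).mono_set Ioc_subset_Icc_self
  · filter_upwards [ae_restrict_mem measurableSet_Ioc] with x hx
    exact h0 x (Ioc_subset_Icc_self hx)

lemma integral_radial {c R : ℝ} (hR : 0 ≤ R) (hc : R ^ 2 < c) :
    ∫⁻ ρ in Ioc 0 R, ENNReal.ofReal (ρ * ((c - ρ ^ 2) ^ 2)⁻¹) =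
      ENNReal.ofReal ((c - R ^ 2)⁻¹ / 2 - c⁻¹ / 2) := by
  have h : ∀ ρ ∈ Icc 0 R, 0 < c - ρ ^ 2 := fun ρ hρ => by
    have := pow_le_pow_left₀ hρ.1 hρ.2 2
    linarith
  have hcont : ContinuousOn (fun ρ : ℝ => ρ * ((c - ρ ^ 2) ^ 2)⁻¹) (Icc 0 R) :=
    continuousOn_id.mul (ContinuousOn.inv₀ (by fun_prop) fun ρ hρ => by
      have := h ρ hρ; positivity)
  rw [lintegral_Ioc_ofReal hR hcont fun ρ hρ => mul_nonneg hρ.1 (by positivity),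
    intervalIntegral.integral_eq_sub_of_hasDerivAt (f := fun ρ => (c - ρ ^ 2)⁻¹ / 2)]
  · simp
  · intro ρ hρ
    rw [uIcc_of_le hR] at hρ
    have h1 := h ρ hρ
    have := (((hasDerivAt_pow 2 ρ).const_sub c).inv h1.ne').div_const 2
    refine this.congr_deriv ?_
    simp only [Nat.cast_ofNat, Nat.add_one_sub_one, pow_one]
    field_simp
  · rw [← uIcc_of_le hR] at hcont
    exact hcont.intervalIntegrable

lemma lintegral_radial_octDensity {m φ z : ℝ} (hm : m = |Real.cos φ| + |Real.sin φ|)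
    (hm1 : 1 < m) (hz : |z| < 1) :
    ∫⁻ ρ in Ioi 0, ENNReal.ofReal ρ * octDensity (ρ * Real.cos φ) (ρ * Real.sin φ) z =
      ENNReal.ofReal ((2 * (1 + |z|) * (m ^ 2 - 1 + (m ^ 2 + 1) * |z|))⁻¹) := by
  have hu := abs_nonneg z
  have hR : 0 ≤ (1 - |z|) / m := div_nonneg (by linarith) (by linarith)
  have hzz : z ^ 2 = |z| ^ 2 := (sq_abs z).symm
  have hpos : 0 < m ^ 2 - 1 + (m ^ 2 + 1) * |z| := by
    have : 0 < m ^ 2 - 1 := by nlinarith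
    positivity
  have key : 1 - |z| ^ 2 - ((1 - |z|) / m) ^ 2 =
      (1 - |z|) * (m ^ 2 - 1 + (m ^ 2 + 1) * |z|) / m ^ 2 := by
    field_simp
    ring
  have hRc : ((1 - |z|) / m) ^ 2 < 1 - |z| ^ 2 := by
    rw [← sub_pos, key]
    have : 0 < 1 - |z| := by linarith
    positivity
  have e : ∀ ρ ∈ Ioi (0 : ℝ),
      ENNReal.ofReal ρ * octDensity (ρ * Real.cos φ) (ρ * Real.sin φ) z =
        (Iic ((1 - |z|) / m)).indicator
          (fun ρ => ENNReal.ofReal (ρ * ((1 - |z| ^ 2 - ρ ^ 2) ^ 2)⁻¹)) ρ := by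
    intro ρ hρ
    rw [mem_Ioi] at hρ
    have e1 : |ρ * Real.cos φ| + |ρ * Real.sin φ| + |z| ≤ 1 ↔ ρ ≤ (1 - |z|) / m := by
      rw [le_div_iff₀ (by linarith), hm, abs_mul, abs_mul, abs_of_pos hρ]
      constructor <;> intro h <;> linarith
    have e2 : (ρ * Real.cos φ) ^ 2 + (ρ * Real.sin φ) ^ 2 + z ^ 2 = ρ ^ 2 + |z| ^ 2 := by
      rw [hzz]; linear_combination ρ ^ 2 * Real.sin_sq_add_cos_sq φ
    simp only [octDensity, e1, e2, indicator]
    by_cases h : ρ ≤ (1 - |z|) / m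
    · have h2 : ρ ^ 2 + |z| ^ 2 < 1 := by
        have := pow_le_pow_left₀ hρ.le h 2
        linarith
      rw [if_pos ⟨h, h2⟩, if_pos (mem_Iic.mpr h), ENNReal.ofReal_mul hρ.le]
      congr 4
      ring
    · rw [if_neg (fun hh => h hh.1), if_neg (by simpa using h), mul_zero]
  rw [setLIntegral_congr_fun measurableSet_Ioi e, lintegral_indicator measurableSet_Iic,
    Measure.restrict_restrict measurableSet_Iic, inter_comm, Ioi_inter_Iic,
    integral_radial hR hRc, key]
  congr 1
  have : 0 < 1 - |z| := by linarith
  rw [show 1 - |z| ^ 2 = (1 - |z|) * (1 + |z|) by ring]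
  -- This form makes the factor 1 - |z| cancel in the difference of the two boundary values.
  have hD : m ^ 2 - 1 + (m ^ 2 + 1) * |z| = m ^ 2 * (1 + |z|) - (1 - |z|) := by ring
  generalize m ^ 2 - 1 + (m ^ 2 + 1) * |z| = D at *
  field_simp
  rw [hD]
  ring

lemma lintegral_radial_octDensity_of_one_le {φ z : ℝ} (hz : 1 ≤ |z|) :
    ∫⁻ ρ in Ioi 0, ENNReal.ofReal ρ * octDensity (ρ * Real.cos φ) (ρ * Real.sin φ) z = 0 := by
  rw [setLIntegral_congr_fun (g := fun _ => 0) measurableSet_Ioi, lintegral_zero]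
  intro ρ hρ
  rw [mem_Ioi] at hρ
  have h : ¬ (|ρ * Real.cos φ| + |ρ * Real.sin φ| + |z| ≤ 1 ∧
      (ρ * Real.cos φ) ^ 2 + (ρ * Real.sin φ) ^ 2 + z ^ 2 < 1) := by
    rintro ⟨-, h⟩
    have := (one_le_sq_iff_one_le_abs z).mpr hz
    nlinarith [sq_nonneg (ρ * Real.cos φ), sq_nonneg (ρ * Real.sin φ)]
  simp only [octDensity, if_neg h, mul_zero]

lemma integral_height {k : ℝ} (hk : 1 < k) :
    ∫ u in (0 : ℝ)..1, (2 * (1 + u) * (k - 1 + (k + 1) * u))⁻¹ =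
      Real.log (k / (k - 1)) / 4 := by
  have h : ∀ u ∈ Icc (0 : ℝ) 1, 0 < 1 + u ∧ 0 < k - 1 + (k + 1) * u := fun u hu =>
    ⟨by linarith [hu.1], by nlinarith [hu.1]⟩
  rw [intervalIntegral.integral_eq_sub_of_hasDerivAt
    (f := fun u => (Real.log (k - 1 + (k + 1) * u) - Real.log (1 + u)) / 4)]
  · simp only [mul_one, mul_zero, add_zero, Real.log_one, sub_zero]
    rw [show k - 1 + (k + 1) = k * (1 + 1) by ring, Real.log_mul (by linarith) (by norm_num),
      Real.log_div (by linarith) (by linarith)]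
    ring
  · intro u hu
    rw [uIcc_of_le zero_le_one] at hu
    obtain ⟨h1, h2⟩ := h u hu
    have d1 := (((hasDerivAt_id u).const_mul (k + 1)).const_add (k - 1)).log h2.ne'
    have d2 := ((hasDerivAt_id u).const_add 1).log h1.ne'
    refine ((d1.sub d2).div_const 4).congr_deriv ?_
    simp only [id, mul_one]
    field_simp
    ring
  · refine ContinuousOn.intervalIntegrable (ContinuousOn.inv₀ (by fun_prop) fun u hu => ?_)
    rw [uIcc_of_le zero_le_one] at hu
    obtain ⟨h1, h2⟩ := h u hu
    positivity

lemma lintegral_height_octDensity {m φ : ℝ} (hm : m = |Real.cos φ| + |Real.sin φ|)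
    (hm1 : 1 < m) :
    ∫⁻ z : ℝ, ∫⁻ ρ in Ioi 0,
        ENNReal.ofReal ρ * octDensity (ρ * Real.cos φ) (ρ * Real.sin φ) z =
      ENNReal.ofReal (Real.log (m ^ 2 / (m ^ 2 - 1)) / 2) := by
  have hk : 1 < m ^ 2 := by nlinarith
  let J : ℝ → ℝ := fun u => (2 * (1 + u) * (m ^ 2 - 1 + (m ^ 2 + 1) * u))⁻¹
  have hpos : ∀ z : ℝ, 0 < 2 * (1 + |z|) * (m ^ 2 - 1 + (m ^ 2 + 1) * |z|) := fun z => by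
    have : 0 < m ^ 2 - 1 := by linarith
    positivity
  have hJ : Continuous fun z => J |z| := Continuous.inv₀ (by fun_prop) fun z => (hpos z).ne'
  have e : (fun z : ℝ => ∫⁻ ρ in Ioi 0,
        ENNReal.ofReal ρ * octDensity (ρ * Real.cos φ) (ρ * Real.sin φ) z) =
      (Ioo (-1) 1).indicator fun z => ENNReal.ofReal (J |z|) := by
    ext z
    by_cases h : |z| < 1
    · rw [indicator_of_mem (s := Ioo (-1) 1) (mem_Ioo.mpr (abs_lt.mp h)), lintegral_radial_octDensity hm hm1 h]
    · rw [indicator_of_notMem (s := Ioo (-1) 1) (fun hh => h (abs_lt.mpr (mem_Ioo.mp hh))),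
        lintegral_radial_octDensity_of_one_le (not_lt.mp h)]
  rw [e, lintegral_indicator measurableSet_Ioo, setLIntegral_congr Ioo_ae_eq_Ioc,
    lintegral_Ioc_ofReal (by norm_num) hJ.continuousOn
      fun z _ => (inv_pos.mpr (hpos z)).le]
  congr 1
  rw [← intervalIntegral.integral_add_adjacent_intervals (b := 0)
    (hJ.intervalIntegrable _ _) (hJ.intervalIntegrable _ _)]
  have h1 : ∫ z in (0 : ℝ)..1, J |z| = Real.log (m ^ 2 / (m ^ 2 - 1)) / 4 := by
    rw [← integral_height hk]
    refine intervalIntegral.integral_congr fun z hz => ?_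
    rw [uIcc_of_le zero_le_one] at hz
    simp only [abs_of_nonneg hz.1, J]
  have h2 : ∫ z in (-1 : ℝ)..0, J |z| = ∫ z in (0 : ℝ)..1, J |z| := by
    have := intervalIntegral.integral_comp_neg (a := 0) (b := 1) fun z => J |z|
    simpa using this.symm
  rw [h2, h1]
  ring

/-! ### The angular integral -/

lemma sq_abs_cos_add_abs_sin (φ : ℝ) :
    (|Real.cos φ| + |Real.sin φ|) ^ 2 = 1 + |Real.sin (2 * φ)| := by
  rw [Real.sin_two_mul, abs_mul, abs_mul, abs_two, add_sq, sq_abs, sq_abs]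
  linarith [Real.sin_sq_add_cos_sq φ]

lemma ae_sin_ne_zero : ∀ᵐ x : ℝ, Real.sin x ≠ 0 := by
  have h : (range fun n : ℤ => (n : ℝ) * Real.pi).Countable := countable_range _
  filter_upwards [h.ae_notMem volume] with x hx h0
  exact hx (Real.sin_eq_zero_iff.mp h0)

lemma ae_sin_two_mul_ne_zero : ∀ᵐ x : ℝ, Real.sin (2 * x) ≠ 0 := by
  have h : (range fun n : ℤ => (n : ℝ) * Real.pi / 2).Countable := countable_range _
  filter_upwards [h.ae_notMem volume] with x hx h0
  obtain ⟨n, hn⟩ := Real.sin_eq_zero_iff.mp h0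
  exact hx ⟨n, by simp only; linarith⟩

/-- The integrand in the angular variable of `v₈`, as a function of twice the angle. -/
noncomputable def angular (s : ℝ) : ℝ := Real.log ((1 + |Real.sin s|) / |Real.sin s|)

lemma angular_nonneg (s : ℝ) : 0 ≤ angular s := by
  unfold angular
  rcases (abs_nonneg (Real.sin s)).eq_or_lt with h | h
  · simp [← h]
  · exact Real.log_nonneg (by rw [le_div_iff₀ h]; linarith)

lemma v8_eq_integral_angular :
    v8 = ∫ φ in (-Real.pi)..Real.pi, angular (2 * φ) / 2 := by
  -- Directions with sin 2φ = 0 are excluded: there m = 1 and the height integral diverges at z = 0.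
  have e : ∀ᵐ φ ∂(volume.restrict (Ioo (-Real.pi) Real.pi)), ∫⁻ z : ℝ, ∫⁻ ρ in Ioi 0,
      ENNReal.ofReal ρ * octDensity (ρ * Real.cos φ) (ρ * Real.sin φ) z =
        ENNReal.ofReal (angular (2 * φ) / 2) := by
    filter_upwards [ae_restrict_of_ae ae_sin_two_mul_ne_zero] with φ hφ
    have h := sq_abs_cos_add_abs_sin φ
    have h0 := abs_pos.mpr hφ
    have h1 : 1 < |Real.cos φ| + |Real.sin φ| := by
      rw [← one_lt_sq_iff₀ (by positivity)]
      linarith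
    rw [lintegral_height_octDensity rfl h1, h, add_sub_cancel_left, angular]
  have hm : Measurable fun φ => angular (2 * φ) / 2 := by unfold angular; fun_prop
  rw [v8, hyperbolicVolume_eq_lintegral, lintegral_octDensity, lintegral_octDensity_polar,
    lintegral_congr_ae e, intervalIntegral.integral_of_le (by linarith [Real.pi_pos]),
    integral_Ioc_eq_integral_Ioo, integral_eq_lintegral_of_nonneg_ae]
  · exact Filter.Eventually.of_forall fun φ => div_nonneg (angular_nonneg _) two_pos.le
  · exact hm.aestronglyMeasurable

lemma angular_periodic : Function.Periodic angular Real.pi := fun s => by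
  simp [angular, Real.sin_add_pi]

/-- The identity 1 + sin s = 2 sin²(s/2 + π/4) expresses the integrand through log(2 sin) alone. -/
lemma angular_eq {s : ℝ} (hs : 0 < s) (hs' : s < Real.pi) :
    angular s = 2 * Real.log (2 * Real.sin (s / 2 + Real.pi / 4)) -
      Real.log (2 * Real.sin s) := by
  have h1 := Real.sin_pos_of_pos_of_lt_pi hs hs'
  have h2 : 0 < Real.sin (s / 2 + Real.pi / 4) :=
    Real.sin_pos_of_pos_of_lt_pi (by linarith) (by linarith)
  have h3 : 2 * Real.sin (s / 2 + Real.pi / 4) ^ 2 = 1 + Real.sin s := by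
    have := Real.cos_sq (s / 2 - Real.pi / 4)
    rw [← Real.sin_add_pi_div_two, show s / 2 - Real.pi / 4 + Real.pi / 2 = s / 2 + Real.pi / 4 by
      ring, show 2 * (s / 2 - Real.pi / 4) = s - Real.pi / 2 by ring,
      Real.cos_sub_pi_div_two] at this
    linarith
  rw [angular, abs_of_pos h1, ← h3, Real.log_div (by positivity) (by positivity),
    Real.log_mul (by norm_num) (by positivity), Real.log_pow, Real.log_mul (by norm_num) h2.ne',
    Real.log_mul (by norm_num) h1.ne']
  push_cast
  ring

lemma logSinPrim_pi : logSinPrim Real.pi = 0 := by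
  have h : ∫ t in (0 : ℝ)..Real.pi, Real.log (2 * Real.sin t) =
      ∫ t in (0 : ℝ)..Real.pi, (Real.log 2 + Real.log (Real.sin t)) := by
    refine intervalIntegral.integral_congr_ae ?_
    filter_upwards [ae_sin_ne_zero] with t ht _
    exact Real.log_mul two_ne_zero ht
  rw [logSinPrim, h, intervalIntegral.integral_add
    (g := fun t => Real.log (Real.sin t)) intervalIntegrable_const intervalIntegrable_log_sin, integral_log_sin_zero_pi]
  simp
  ring

lemma logSinPrim_pi_sub (x : ℝ) : logSinPrim (Real.pi - x) = -logSinPrim x := by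
  have h := logSinPrim_sub (Real.pi - x) Real.pi
  have h2 := intervalIntegral.integral_comp_sub_left (a := 0) (b := x)
    (fun t => Real.log (2 * Real.sin t)) Real.pi
  simp only [Real.sin_pi_sub, sub_zero] at h2
  rw [← h2, logSinPrim_pi] at h
  have h3 : ∫ t in (0 : ℝ)..x, Real.log (2 * Real.sin t) = logSinPrim x := rfl
  linarith

lemma logSinPrim_pi_div_two : logSinPrim (Real.pi / 2) = 0 := by
  have := logSinPrim_pi_sub (Real.pi / 2)
  rw [sub_half] at this
  linarith

lemma integral_angular :
    ∫ s in (0 : ℝ)..Real.pi, angular s = -8 * logSinPrim (Real.pi / 4) := by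
  have hpi := Real.pi_pos
  have hi : IntervalIntegrable
      (fun s => 2 * Real.log (2 * Real.sin (s / 2 + Real.pi / 4))) volume 0 Real.pi := by
    have : AnalyticOnNhd ℝ (fun s => 2 * Real.sin (s / 2 + Real.pi / 4)) univ := fun x _ => by
      fun_prop
    exact (MeromorphicOn.intervalIntegrable_log
      (f := fun s => 2 * Real.sin (s / 2 + Real.pi / 4))
      (fun x _ => (this x trivial).meromorphicAt)).const_mul 2
  have h : ∫ s in (0 : ℝ)..Real.pi, angular s =
      ∫ s in (0 : ℝ)..Real.pi, (2 * Real.log (2 * Real.sin (s / 2 + Real.pi / 4)) -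
        Real.log (2 * Real.sin s)) := by
    rw [intervalIntegral.integral_of_le hpi.le, intervalIntegral.integral_of_le hpi.le,
      integral_Ioc_eq_integral_Ioo, integral_Ioc_eq_integral_Ioo]
    exact setIntegral_congr_fun measurableSet_Ioo fun s hs => angular_eq hs.1 hs.2
  rw [h, intervalIntegral.integral_sub hi (intervalIntegrable_log_two_sin _ _),
    intervalIntegral.integral_const_mul, ← logSinPrim, logSinPrim_pi]
  have h2 := intervalIntegral.integral_comp_div_add (a := 0) (b := Real.pi)
    (fun t => Real.log (2 * Real.sin t)) two_ne_zero (Real.pi / 4)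
  rw [h2, ← logSinPrim_sub, show Real.pi / 2 + Real.pi / 4 = Real.pi - Real.pi / 4 by ring,
    logSinPrim_pi_sub]
  simp
  ring

theorem v8_eq : v8 = -8 * logSinPrim (Real.pi / 4) := by
  rw [v8_eq_integral_angular, ← integral_angular, intervalIntegral.integral_div,
    intervalIntegral.integral_comp_mul_left (fun s => angular s) two_ne_zero]
  have hint (a b : ℝ) : IntervalIntegrable angular volume a b := by
    have h : Continuous fun s => Real.log (1 + |Real.sin s|) :=
      Continuous.log (by fun_prop) fun s => by positivity
    refine ((h.intervalIntegrable a b).sub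
      (intervalIntegrable_log_sin (a := a) (b := b))).congr_ae ?_
    filter_upwards [ae_restrict_of_ae ae_sin_ne_zero] with s hs
    rw [angular, Real.log_div (by positivity) (abs_pos.mpr hs).ne', Real.log_abs]
    rfl
  -- The interval from -2π to 2π is four periods, which offsets the factor 1/2 of the integrand and
  -- the 1/2 from s = 2φ.
  have h := angular_periodic.intervalIntegral_add_zsmul_eq 4 (2 * -Real.pi) hint
  rw [angular_periodic.intervalIntegral_add_eq _ 0, zero_add, zsmul_eq_mul, zsmul_eq_mul,
    show 2 * -Real.pi + (4 : ℤ) * Real.pi = 2 * Real.pi by push_cast; ring] at h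
  rw [h]
  simp
  ring

end QuantumSixJ

namespace QuantumSixJ

/-! ### Asymptotics of the `6j`-symbols -/

open Filter

lemma tendsto_ratio {l : Filter ℕ} (hl : l ≤ atTop) {m : ℕ → ℕ} {c C : ℝ}
    (h : ∀ᶠ r in l, |(m r : ℝ) - c * r| ≤ C) :
    Tendsto (fun r : ℕ => (m r : ℝ) / r) l (𝓝 c) := by
  rw [tendsto_iff_norm_sub_tendsto_zero]
  refine squeeze_zero' (Eventually.of_forall fun _ => norm_nonneg _) ?_
    ((tendsto_const_div_atTop_nhds_zero_nat C).mono_left hl)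
  filter_upwards [h, hl (eventually_gt_atTop 0)] with r hr hr0
  have hr0' : (0 : ℝ) < r := by exact_mod_cast hr0
  rw [Real.norm_eq_abs, div_sub' hr0'.ne', abs_div, abs_of_pos hr0', mul_comm (r : ℝ)]
  gcongr

lemma admissible_two_mul {r N : ℕ} (h : 4 * N ≤ r + 1) (h' : r ≤ 4 * N + 1) (h2 : 3 ≤ N) :
    Admissible r (2 * N) (2 * N) (2 * N) (2 * N) (2 * N) (2 * N) := by
  have : AdmissibleTriple r (2 * N) (2 * N) (2 * N) :=
    ⟨by omega, ⟨⟨3 * N, by ring⟩, by omega⟩, by omega⟩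
  exact ⟨this, this, this, this⟩

lemma tendsto_log_sixJ {l : Filter ℕ} (hl : l ≤ atTop) (hodd : ∀ᶠ r in l, Odd r) {N : ℕ → ℕ}
    (hN : ∀ᶠ r in l, 4 * N r ≤ r + 1 ∧ r ≤ 4 * N r + 1) :
    Tendsto (fun r : ℕ => 2 * Real.pi / (r : ℝ) *
        Real.log ‖sixJ r (2 * N r) (2 * N r) (2 * N r) (2 * N r) (2 * N r) (2 * N r)‖) l
      (𝓝 (-8 * logSinPrim (Real.pi / 4))) := by
  let d : ℕ → ℕ := fun r => 4 * N r + 2 - r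
  have hbase : ∀ᶠ r in l, Odd r ∧ 4 * N r ≤ r + 1 ∧ r ≤ 4 * N r + 1 ∧ 8 ≤ N r ∧
      r + d r = 4 * N r + 2 ∧ d r ≤ 3 := by
    filter_upwards [hodd, hN, hl (eventually_ge_atTop 40)] with r h1 h2 h3
    simp only [d]
    exact ⟨h1, by omega⟩
  -- The value 40 is a generous slack covering the rounding and the shifts by d in all the indices
  -- below.
  have lim {m : ℕ → ℕ} (k : ℕ) (hk : 0 < k) (h1 : ∀ᶠ r in l, r ≤ k * m r + 40)
      (h2 : ∀ᶠ r in l, k * m r ≤ r + 40) (h3 : ∀ᶠ r in l, 4 * m r ≤ r) :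
      Tendsto (fun r : ℕ => 2 * Real.pi / (r : ℝ) * Real.log (sineProd r (m r))) l
        (𝓝 (logSinPrim (2 * Real.pi * (1 / k)))) := by
    refine tendsto_log_sineProd hl (tendsto_ratio hl (C := 40 / k) ?_) h3
    filter_upwards [h1, h2] with r h1 h2
    have h1' : (r : ℝ) ≤ k * m r + 40 := by exact_mod_cast h1
    have h2' : (k : ℝ) * m r ≤ r + 40 := by exact_mod_cast h2
    have hk' : (0 : ℝ) < k := by exact_mod_cast hk
    rw [le_div_iff₀ hk', ← abs_of_pos hk', ← abs_mul, abs_of_pos hk', abs_le, sub_mul,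
      show 1 / (k : ℝ) * r * k = r by field_simp]
    constructor <;> linarith
  have eighth : 2 * Real.pi * (1 / (8 : ℕ)) = Real.pi / 4 := by push_cast; ring
  have quarter : 2 * Real.pi * (1 / (4 : ℕ)) = Real.pi / 2 := by push_cast; ring
  have l8a : Tendsto (fun r : ℕ => 2 * Real.pi / (r : ℝ) *
      Real.log (sineProd r (N r / 2))) l (𝓝 (logSinPrim (Real.pi / 4))) := by
    rw [← eighth]
    refine lim 8 (by norm_num) (hbase.mono fun r hr => by omega)
      (hbase.mono fun r hr => by omega) (hbase.mono fun r hr => by omega)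
  have l8b : Tendsto (fun r : ℕ => 2 * Real.pi / (r : ℝ) *
      Real.log (sineProd r (N r - N r / 2))) l (𝓝 (logSinPrim (Real.pi / 4))) := by
    rw [← eighth]
    refine lim 8 (by norm_num) (hbase.mono fun r hr => by omega)
      (hbase.mono fun r hr => by omega) (hbase.mono fun r hr => by omega)
  have l8c : Tendsto (fun r : ℕ => 2 * Real.pi / (r : ℝ) *
      Real.log (sineProd r (N r / 2 - d r))) l (𝓝 (logSinPrim (Real.pi / 4))) := by
    rw [← eighth]
    refine lim 8 (by norm_num) (hbase.mono fun r hr => by omega)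
      (hbase.mono fun r hr => by omega) (hbase.mono fun r hr => by omega)
  have l4a : Tendsto (fun r : ℕ => 2 * Real.pi / (r : ℝ) *
      Real.log (sineProd r (N r - d r))) l (𝓝 0) := by
    rw [← logSinPrim_pi_div_two, ← quarter]
    refine lim 4 (by norm_num) (hbase.mono fun r hr => by omega)
      (hbase.mono fun r hr => by omega) (hbase.mono fun r hr => by omega)
  -- When r = 4N - 1, the index N violates 4m ≤ r, so the last factor of S(N), which tends to 2, is
  -- split off.
  have l4b : Tendsto (fun r : ℕ => 2 * Real.pi / (r : ℝ) *
      Real.log (sineProd r (N r - 1))) l (𝓝 0) := by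
    rw [← logSinPrim_pi_div_two, ← quarter]
    refine lim 4 (by norm_num) (hbase.mono fun r hr => by omega)
      (hbase.mono fun r hr => by omega) (hbase.mono fun r hr => by omega)
  have l4c : Tendsto (fun r : ℕ => 2 * Real.pi / (r : ℝ) *
      Real.log (sineTwo r (N r))) l (𝓝 0) := by
    have h1 : Tendsto (fun r : ℕ => (N r : ℝ) / r) l (𝓝 (1 / (4 : ℕ))) := by
      refine tendsto_ratio hl (C := 1) ?_
      filter_upwards [hbase] with r hr
      have h1' : (r : ℝ) ≤ 4 * N r + 1 := by exact_mod_cast hr.2.2.1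
      have h2' : 4 * (N r : ℝ) ≤ r + 1 := by exact_mod_cast hr.2.1
      push_cast
      rw [abs_le]; constructor <;> linarith
    have h2 : Tendsto (fun r : ℕ => Real.log (sineTwo r (N r))) l
        (𝓝 (Real.log (2 * Real.sin (Real.pi / 2)))) := by
      refine Tendsto.log ?_ (by simp)
      refine (((Real.continuous_sin.tendsto _).comp ?_).const_mul 2)
      rw [← quarter]
      refine (h1.const_mul (2 * Real.pi)).congr fun r => ?_
      ring
    simpa using (tendsto_two_pi_div hl).mul h2
  have l4 : Tendsto (fun r : ℕ => 2 * Real.pi / (r : ℝ) *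
      Real.log (sineProd r (N r))) l (𝓝 0) := by
    have := l4b.add l4c
    rw [add_zero] at this
    refine this.congr' ?_
    filter_upwards [hbase] with r hr
    rw [← mul_add, ← Real.log_mul (sineProd_pos (by omega)).ne'
      (sineTwo_pos (by omega) (by omega)).ne']
    have := sineProd_succ r (N r - 1)
    rw [Nat.sub_add_cancel (by omega)] at this
    rw [this]
  have l0 : Tendsto (fun r : ℕ => 2 * Real.pi / (r : ℝ) * Real.log (zeta r)) l (𝓝 0) := by
    have := tendsto_log_sineProd hl (m := fun _ => 1) (c := 0)
      (by simpa using (tendsto_const_div_atTop_nhds_zero_nat (1 : ℝ)).mono_left hl)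
      (by filter_upwards [hl (eventually_ge_atTop 4)] with r hr; omega)
    simpa [sineProd_one, logSinPrim_zero] using this
  have lr := tendsto_log_nat hl
  have lsum : Tendsto (fun r : ℕ => 2 * Real.pi / (r : ℝ) *
      Real.log (∑ j ∈ Finset.range (N r + 1), summand r (N r) j)) l
      (𝓝 (-8 * logSinPrim (Real.pi / 4))) := by
    have lo := ((lr.sub l8c).sub (l8b.const_mul 4)).sub (l8a.const_mul 3)
    -- One log r comes from the numerator of each term, the other bounds log(N + 1) for the number
    -- of terms.
    have up := (((lr.const_mul 2).add ((tendsto_two_pi_div hl).mul_const (Real.log 8))).sub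
      (l8a.const_mul 4)).sub (l8b.const_mul 4)
    rw [show (0 - logSinPrim (Real.pi / 4) - 4 * logSinPrim (Real.pi / 4) -
      3 * logSinPrim (Real.pi / 4)) = -8 * logSinPrim (Real.pi / 4) by ring] at lo
    rw [show (2 * 0 + 0 * Real.log 8 - 4 * logSinPrim (Real.pi / 4) -
      4 * logSinPrim (Real.pi / 4)) = -8 * logSinPrim (Real.pi / 4) by ring] at up
    refine tendsto_of_tendsto_of_tendsto_of_le_of_le' lo up ?_ ?_
    · filter_upwards [hbase] with r ⟨ho, h1, h2, h3, h4, h5⟩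
      have p0 : (0 : ℝ) < r := by exact_mod_cast ho.pos
      have p1 : 0 < sineProd r (N r / 2) := sineProd_pos (by omega)
      have p2 : 0 < sineProd r (N r - N r / 2) := sineProd_pos (by omega)
      have p3 : 0 < sineProd r (N r / 2 - d r) := sineProd_pos (by omega)
      have h := Real.log_le_log (by positivity) (le_sum_summand ho h4 h5 (by omega))
      rw [Real.log_div (by positivity) (by positivity), Real.log_mul (by positivity)
        (by positivity), Real.log_mul (by positivity) (by positivity), Real.log_pow,
        Real.log_pow] at h
      push_cast at h
      have hh : 0 ≤ 2 * Real.pi / (r : ℝ) := by have := Real.pi_pos; positivity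
      refine le_trans (le_of_eq ?_) (mul_le_mul_of_nonneg_left h hh)
      ring
    · filter_upwards [hbase] with r ⟨ho, h1, h2, h3, h4, h5⟩
      have p0 : (0 : ℝ) < r := by exact_mod_cast ho.pos
      have p1 : 0 < sineProd r (N r / 2) := sineProd_pos (by omega)
      have p2 : 0 < sineProd r (N r - N r / 2) := sineProd_pos (by omega)
      have p3 : 0 < sineProd r (N r / 2 - d r) := sineProd_pos (by omega)
      have hpos : 0 < ∑ j ∈ Finset.range (N r + 1), summand r (N r) j :=
        lt_of_lt_of_le (by positivity) (le_sum_summand ho h4 h5 (by omega))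
      have h := Real.log_le_log hpos (sum_summand_le ho h4 h5 (by omega))
      rw [Real.log_mul (by positivity) (by positivity), Real.log_mul (by positivity)
        (by positivity), Real.log_div (by positivity) (by positivity), Real.log_pow,
        Real.log_mul (by positivity) (by positivity)] at h
      have hN' : Real.log (N r + 1) ≤ Real.log r := by
        refine Real.log_le_log (by positivity) ?_
        have : N r + 1 ≤ r := by omega
        exact_mod_cast this
      push_cast at h
      have hh : 0 ≤ 2 * Real.pi / (r : ℝ) := by have := Real.pi_pos; positivity
      refine (mul_le_mul_of_nonneg_left (h.trans (add_le_add_left hN' _)) hh).trans (le_of_eq ?_)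
      ring
  have total := (((l0.add (l4.const_mul 6)).add (l4a.const_mul 2)).sub (lr.const_mul 2)).add lsum
  rw [show (0 + 6 * 0 + 2 * 0 - 2 * 0 + -8 * logSinPrim (Real.pi / 4)) =
    -8 * logSinPrim (Real.pi / 4) by ring] at total
  refine total.congr' ?_
  filter_upwards [hbase] with r ⟨ho, h1, h2, h3, h4, h5⟩
  have p0 : (0 : ℝ) < r := by exact_mod_cast ho.pos
  have p1 : 0 < sineProd r (N r / 2) := sineProd_pos (by omega)
  have p2 : 0 < sineProd r (N r - N r / 2) := sineProd_pos (by omega)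
  have p3 : 0 < sineProd r (N r / 2 - d r) := sineProd_pos (by omega)
  have p4 : 0 < sineProd r (N r - d r) := sineProd_pos (by omega)
  have p5 : 0 < sineProd r (N r) := sineProd_pos (by omega)
  have p6 : 0 < zeta r := by rw [← sineProd_one]; exact sineProd_pos (by omega)
  have hpos : 0 < ∑ j ∈ Finset.range (N r + 1), summand r (N r) j :=
    lt_of_lt_of_le (by positivity) (le_sum_summand ho h4 h5 (by omega))
  rw [norm_sixJ ho h1 h2 (by omega), abs_sineProd_three_mul ho h4 (by omega) h5, abs_of_pos p5,
    abs_of_pos p6, Real.log_mul (by positivity) hpos.ne', Real.log_div (by positivity)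
    (by positivity), Real.log_mul (by positivity) (by positivity), Real.log_pow, Real.log_pow,
    Real.log_div (by positivity) (by positivity)]
  push_cast
  ring

end QuantumSixJ

/-- For each odd `r`, the color `n r` is whichever of `(r + 1) / 2` and `(r - 1) / 2` is even.
The limit is taken as `r` tends to infinity through the odd numbers. -/
theorem mainTheorem6 (n : ℕ → ℕ)
    (hn : ∀ r : ℕ, 3 ≤ r → Odd r →
      Even (n r) ∧ ((n r : ℝ) = ((r : ℝ) + 1) / 2 ∨ (n r : ℝ) = ((r : ℝ) - 1) / 2)) :
    (∀ᶠ r in Filter.atTop ⊓ Filter.principal {r : ℕ | Odd r},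
      QuantumSixJ.Admissible r (n r) (n r) (n r) (n r) (n r) (n r)) ∧
    Filter.Tendsto
      (fun r : ℕ => 2 * Real.pi / (r : ℝ) *
        Real.log ‖QuantumSixJ.sixJ r (n r) (n r) (n r) (n r) (n r) (n r)‖)
      (Filter.atTop ⊓ Filter.principal {r : ℕ | Odd r}) (𝓝 QuantumSixJ.v8) := by
  have hodd : ∀ᶠ r in Filter.atTop ⊓ Filter.principal {r : ℕ | Odd r}, Odd r :=
    Filter.mem_inf_of_right (Filter.mem_principal_self _)
  have hN : ∀ᶠ r in Filter.atTop ⊓ Filter.principal {r : ℕ | Odd r},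
      n r = 2 * (n r / 2) ∧ 4 * (n r / 2) ≤ r + 1 ∧ r ≤ 4 * (n r / 2) + 1 ∧ 3 ≤ n r / 2 := by
    filter_upwards [hodd, Filter.mem_inf_of_left (Filter.eventually_ge_atTop 20)] with r ho hr
    obtain ⟨he, h⟩ := hn r (by omega) ho
    have h' : 2 * n r = r + 1 ∨ 2 * n r + 1 = r := by
      rcases h with h | h
      · left
        have : (2 * n r : ℝ) = r + 1 := by linarith
        exact_mod_cast this
      · right
        have : (2 * n r + 1 : ℝ) = r := by linarith
        exact_mod_cast this
    obtain ⟨k, hk⟩ := he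
    omega
  refine ⟨?_, ?_⟩
  · filter_upwards [hN] with r ⟨h1, h2, h3, h4⟩
    rw [h1]
    exact QuantumSixJ.admissible_two_mul h2 h3 h4
  · rw [QuantumSixJ.v8_eq]
    refine (QuantumSixJ.tendsto_log_sixJ inf_le_left hodd (N := fun r => n r / 2)
      (hN.mono fun r h => ⟨h.2.1, h.2.2.1⟩)).congr' ?_
    filter_upwards [hN] with r h
    rw [← h.1]
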